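/- **Conventions.** All diffeomorphisms are $C^\infty$. A PDF is taken with respect to Lebesgue measure and its support is the set of points where it is nonzero. A PDF $p$ has a *non-removable discontinuity* at $z$ if every PDF that yields the same probability measure as $p$ is discontinuous at $z$; only such points in the support of $p$ are considered. Let $S\subset\mathbb{R}^d$ be open and connected, and write $\Gamma_S(i,\tau)=\{z\in S: z_i=\tau\}$. This set is an *axis-separator* of $S$ if it is connected and $S\setminus\Gamma_S(i,\tau)$ has exactly two connected components. A *discrete coordination* $\mathbf{A}=(\mathbf{A}_1,\dots,\mathbf{A}_d)$ consists of finite strictly increasing tuples $\mathbf{A}_i=(\mathbf{A}_{i,1},\dots,\mathbf{A}_{i,n_i})$ of reals. A set $G$ is an *axis-aligned grid* in $S$ with discrete coordination $\mathbf{A}$ if every $\Gamma_S(i,\mathbf{A}_{i,k})$ is an axis-separator of $S$ and $G=\bigcup_{i,k}\Gamma_S(i,\mathbf{A}_{i,k})$. It has a *backbone* if one can choose a separator $\mathcal{H}^*_i=\Gamma_S(i,\mathbf{A}_{i,k_i})$ on each axis $i$ so that $\bigcap_i\mathcal{H}^*_i$ is a single point and, for all $i\neq j$ and all $l$, $\mathcal{H}^*_i\cap\Gamma_S(j,\mathbf{A}_{j,l})\neq\emptyset$.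 For $z\in\mathbb{R}$ and a tuple $T$ of reals put $Q^{+1}(z;T)=Q(z;T)=\#\{k: z\ge T_k\}$ and $Q^{-1}(z;T)=\#\{k: z\le T_k\}$. **Theorem.** Let $Z$ be a random vector with values in $\mathcal{Z}\subset\mathbb{R}^d$ and PDF $p_Z$, whose support $S\subset\mathcal{Z}$ is open and connected. Let $f:\mathcal{Z}\to\mathcal{X}\subset\mathbb{R}^D$ be a diffeomorphism and $X=f(Z)$. Assume that the set of non-removable discontinuities of $p_Z$ in $S$ is an axis-aligned grid in $S$ with discrete coordination $\mathbf{A}$ that has a backbone (in particular, there is at least one separator on each axis). For a diffeomorphism $g:\mathcal{X}\to\mathcal{Z}'\subset\mathbb{R}^d$ let $Z'=g(X)$, and let $p_{Z'}$ be a PDF of $Z'$ with support $S'=g(f(S))$, as given by the change of variables formula. 1. There exists a diffeomorphism $g:\mathcal{X}\to\mathcal{Z}'$ such that the set of non-removable discontinuities of $p_{Z'}$ in $S'$ is an axis-aligned grid in $S'$, with at least one separator on each axis. 2. For any diffeomorphism $g:\mathcal{X}\to\mathcal{Z}'$ such that the set of non-removable discontinuities of $p_{Z'}$ in $S'$ is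 an axis-aligned grid in $S'$, with discrete coordination $\mathbf{B}$, there exist a permutation $\sigma$ of $\{1,\dots,d\}$ and $s\in\{-1,+1\}^d$ such that, almost surely, for all $i$, $$Q^{s_i}(Z'_{\sigma(i)};\mathbf{B}_{\sigma(i)})=Q(Z_i;\mathbf{A}_i).$$ Moreover, with $h=g\circ f$, the identity $Q^{s_i}(h(z)_{\sigma(i)};\mathbf{B}_{\sigma(i)})=Q(z_i;\mathbf{A}_i)$ holds for every $z\in S$ and every $i$. -/

import Mathlib

open MeasureTheory Set

/-- `ℝ^d` with its Euclidean structure and Lebesgue measure. -/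
abbrev Euc (d : ℕ) : Type := EuclideanSpace ℝ (Fin d)

/-! ### Diffeomorphisms between subsets of Euclidean spaces -/

/-- `f` restricts to a `C^∞` diffeomorphism from `U` onto `V`. Only the values of `f` on `U`
matter. When `U` is open, this says that `V` is an embedded submanifold and that `f : U → V` is a
diffeomorphism. -/
structure IsDiffeoOn {m n : ℕ} (f : Euc m → Euc n) (U : Set (Euc m)) (V : Set (Euc n)) :
    Prop where
  bijOn : BijOn f U V
  contDiffOn : ContDiffOn ℝ (⊤ : ℕ∞) f U
  exists_inv : ∃ f' : Euc n → Euc m, InvOn f' f U V ∧ ContDiffOn ℝ (⊤ : ℕ∞) f' V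

/-! ### Probability densities and their discontinuities -/

/-- `p` is a probability density function (with respect to Lebesgue measure) of the random
vector `Z`. -/
structure IsPDFOf {Ω : Type*} [MeasurableSpace Ω] {d : ℕ} (p : Euc d → ℝ) (Z : Ω → Euc d)
    (P : Measure Ω) : Prop where
  measurable : Measurable p
  nonneg : ∀ z, 0 ≤ p z
  map_eq : P.map Z = volume.withDensity fun z => ENNReal.ofReal (p z)

/-- `q` is a density in the equivalence class of the density `p`: it yields the same measure. -/
def SameDistribution {d : ℕ} (p q : Euc d → ℝ) : Prop :=
  Measurable q ∧ (∀ z, 0 ≤ q z) ∧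
    (volume.withDensity fun z => ENNReal.ofReal (q z)) =
      volume.withDensity fun z => ENNReal.ofReal (p z)

/-- `p` is discontinuous at `z`, but some density in its equivalence class is continuous there. -/
def IsRemovableDiscontinuity {d : ℕ} (p : Euc d → ℝ) (z : Euc d) : Prop :=
  ¬ ContinuousAt p z ∧ ∃ q, SameDistribution p q ∧ ContinuousAt q z

/-- `p` has a discontinuity at `z` that is not removable. -/
def IsNonRemovableDiscontinuity {d : ℕ} (p : Euc d → ℝ) (z : Euc d) : Prop :=
  ¬ ContinuousAt p z ∧ ¬ IsRemovableDiscontinuity p z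

/-- The non-removable discontinuities of `p` in its support `{z | p z ≠ 0}`. -/
def nonRemovableDiscontinuities {d : ℕ} (p : Euc d → ℝ) : Set (Euc d) :=
  {z | z ∈ Function.support p ∧ IsNonRemovableDiscontinuity p z}

/-! ### Axis-separators, grids and backbones -/

/-- `split(S, C)`: the set of connected components of `S \ C`. -/
def splitting {d : ℕ} (S C : Set (Euc d)) : Set (Set (Euc d)) :=
  {K | ∃ z ∈ S \ C, K = connectedComponentIn (S \ C) z}

/-- A separator of `S`: a connected subset of `S` that splits `S` in two. -/
def IsSeparator {d : ℕ} (S C : Set (Euc d)) : Prop :=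
  C ⊆ S ∧ IsConnected C ∧ (splitting S C).encard = 2

/-- `Γ_S(i, τ) = {z ∈ S | z_i = τ}`. -/
def slice {d : ℕ} (S : Set (Euc d)) (i : Fin d) (τ : ℝ) : Set (Euc d) :=
  {z | z ∈ S ∧ z i = τ}

/-- `Γ_S(i, τ)` is an axis-separator of `S`. For open `S`, a nonempty `Γ_S(i, τ)` is a nonempty
relatively open subset of an affine hyperplane, hence automatically a smooth hypersurface. -/
def IsAxisSeparator {d : ℕ} (S : Set (Euc d)) (i : Fin d) (τ : ℝ) : Prop :=
  IsSeparator S (slice S i τ)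

/-- A discrete coordination: for each axis `i`, a finite strictly increasing tuple of reals. -/
structure DiscreteCoordination (d : ℕ) where
  /-- The number of thresholds on each axis. -/
  size : Fin d → ℕ
  /-- The thresholds on each axis. -/
  thr : (i : Fin d) → Fin (size i) → ℝ
  strictMono : ∀ i, StrictMono (thr i)

/-- `grid_S(A)`: the union of all slices of `S` prescribed by `A`. -/
def gridSet {d : ℕ} (S : Set (Euc d)) (A : DiscreteCoordination d) : Set (Euc d) :=
  ⋃ (i : Fin d) (k : Fin (A.size i)), slice S i (A.thr i k)

/-- `G` is an axis-aligned grid in `S` with discrete coordination `A`: every slice prescribed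
by `A` is an axis-separator of `S`, and `G` is their union. -/
def IsAxisAlignedGrid {d : ℕ} (S G : Set (Euc d)) (A : DiscreteCoordination d) : Prop :=
  (∀ i k, IsAxisSeparator S i (A.thr i k)) ∧ G = gridSet S A

/-- The grid in `S` with coordination `A` has a backbone: one separator on each axis, meeting in
a single point, each of which intersects all separators of the grid on the other axes. -/
def HasBackbone {d : ℕ} (S : Set (Euc d)) (A : DiscreteCoordination d) : Prop :=
  ∃ k : (i : Fin d) → Fin (A.size i),
    (∃ z, ⋂ i, slice S i (A.thr i (k i)) = {z}) ∧
    ∀ i j, j ≠ i → ∀ l : Fin (A.size j),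
      (slice S i (A.thr i (k i)) ∩ slice S j (A.thr j l)).Nonempty

/-! ### Quantization -/

/-- `Q(z; T)`, the number of `k` with `z ≥ T_k`. -/
noncomputable def quantize {n : ℕ} (z : ℝ) (T : Fin n → ℝ) : ℕ :=
  ∑ k, if z ≥ T k then 1 else 0

/-- `Q⁻(z; T)`, the number of `k` with `z ≤ T_k`. -/
noncomputable def quantizeRev {n : ℕ} (z : ℝ) (T : Fin n → ℝ) : ℕ :=
  ∑ k, if z ≤ T k then 1 else 0

/-- `Q^s(z; T)` for a sign `s ∈ {-1, +1}`. -/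
noncomputable def quantizeSign {n : ℕ} (s : ℤˣ) (z : ℝ) (T : Fin n → ℝ) : ℕ :=
  if s = 1 then quantize z T else quantizeRev z T

/-! Change of variables by `h = g ∘ f` carries a density continuous at `z` to one continuous at `h
z`, and its inverse does the converse. Hence `h` carries the first grid onto the second
(`mapsTo_nonRemovableDiscontinuities`), and the rest is geometry of diffeomorphisms between grids.

A slice could a priori bend from one slice of the target grid into another where they cross.
Smoothness forbids this: along a slice, the coordinate of `h` that is locally constant has a
differential vanishing on the hyperplane, and invertibility of the differential allows only one such
coordinate. Baire and connectedness make the choice global (`exists_mapsTo_slice`), so `h` and its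
inverse match whole separators.

Parallel distinct slices are disjoint, so crossing separators go to different axes; the backbone
thus yields a permutation of axes (`exists_axis_perm`). Both sides of a separator are connected, so
`h` preserves or exchanges them (`SlicesMatch.sides`), with the same choice along an axis
(`not_opposite_orientation`). Counting separators on one side gives the quantized coordinates. -/

open Filter Topology

/-! ### Diffeomorphisms between open subsets of `ℝ^d` -/

/-- `h : S → T` and `k : T → S` are mutually inverse `C^∞` maps between open subsets of `ℝ^d`. -/
structure IsOpenDiffeo {d : ℕ} (h k : Euc d → Euc d) (S T : Set (Euc d)) : Prop where
  isOpen_source : IsOpen S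
  isOpen_target : IsOpen T
  mapsTo : MapsTo h S T
  mapsTo_inv : MapsTo k T S
  invOn : InvOn k h S T
  contDiffOn : ContDiffOn ℝ (⊤ : ℕ∞) h S
  contDiffOn_inv : ContDiffOn ℝ (⊤ : ℕ∞) k T

namespace IsOpenDiffeo

variable {d : ℕ} {h k : Euc d → Euc d} {S T : Set (Euc d)}

theorem symm (H : IsOpenDiffeo h k S T) : IsOpenDiffeo k h T S :=
  ⟨H.isOpen_target, H.isOpen_source, H.mapsTo_inv, H.mapsTo, H.invOn.symm, H.contDiffOn_inv,
    H.contDiffOn⟩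

theorem left_inv (H : IsOpenDiffeo h k S T) {z : Euc d} (hz : z ∈ S) : k (h z) = z :=
  H.invOn.1 hz

theorem right_inv (H : IsOpenDiffeo h k S T) {y : Euc d} (hy : y ∈ T) : h (k y) = y :=
  H.invOn.2 hy

theorem continuousOn (H : IsOpenDiffeo h k S T) : ContinuousOn h S :=
  H.contDiffOn.continuousOn

theorem continuousOn_apply (H : IsOpenDiffeo h k S T) (j : Fin d) :
    ContinuousOn (fun z => h z j) S :=
  (EuclideanSpace.proj (𝕜 := ℝ) j).continuous.comp_continuousOn H.continuousOn

theorem continuousOn_fderiv (H : IsOpenDiffeo h k S T) : ContinuousOn (fderiv ℝ h) S :=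
  H.contDiffOn.continuousOn_fderiv_of_isOpen H.isOpen_source (by simp)

theorem hasFDerivAt (H : IsOpenDiffeo h k S T) {z : Euc d} (hz : z ∈ S) :
    HasFDerivAt h (fderiv ℝ h z) z :=
  ((H.contDiffOn.contDiffAt (H.isOpen_source.mem_nhds hz)).differentiableAt
    (by simp)).hasFDerivAt

/-- The differential of a map with a differentiable left inverse is surjective, by dimension. -/
theorem surjective_of_leftInvOn {h k : Euc d → Euc d} {S T : Set (Euc d)} (hS : IsOpen S)
    (hST : MapsTo h S T) (hkh : LeftInvOn k h S) {z : Euc d} (hz : z ∈ S)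
    {L : Euc d →L[ℝ] Euc d} (hL : HasFDerivAt h L z) (hk : DifferentiableWithinAt ℝ k T (h z)) :
    Function.Surjective L := by
  have hcomp : HasFDerivAt (k ∘ h) ((fderivWithin ℝ k T (h z)).comp L) z :=
    (hk.hasFDerivWithinAt.comp z hL.hasFDerivWithinAt hST).hasFDerivAt (hS.mem_nhds hz)
  have hid : HasFDerivAt (k ∘ h) (ContinuousLinearMap.id ℝ (Euc d)) z :=
    (hasFDerivAt_id z).congr_of_eventuallyEq (by
      filter_upwards [hS.mem_nhds hz] with w hw using hkh hw)
  have heq := hcomp.unique hid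
  have hinj : Function.Injective L.toLinearMap := by
    refine Function.LeftInverse.injective (g := fderivWithin ℝ k T (h z)) fun v => ?_
    simpa using congrArg (fun M : Euc d →L[ℝ] Euc d => M v) heq
  exact LinearMap.injective_iff_surjective.1 hinj

/-- The image is open because the strict differential of `h` is surjective at each point, so that
`h` maps neighbourhoods onto neighbourhoods. -/
theorem of_image (hS : IsOpen S) (hinv : LeftInvOn k h S)
    (hh : ContDiffOn ℝ (⊤ : ℕ∞) h S) (hk : ContDiffOn ℝ (⊤ : ℕ∞) k (h '' S)) :
    IsOpenDiffeo h k S (h '' S) := by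
  refine ⟨hS, ?_, mapsTo_image h S, ?_, ⟨hinv, ?_⟩, hh, hk⟩
  · rw [isOpen_iff_mem_nhds]
    rintro _ ⟨z, hz, rfl⟩
    have hzc := hh.contDiffAt (hS.mem_nhds hz)
    have hstrict := hzc.hasStrictFDerivAt (by simp)
    have hsurj := surjective_of_leftInvOn hS (mapsTo_image h S) hinv hz hstrict.hasFDerivAt
      ((hk.differentiableOn (by simp)) _ (mem_image_of_mem h hz))
    rw [← hstrict.map_nhds_eq_of_surj (LinearMap.range_eq_top.2 hsurj)]
    exact image_mem_map (hS.mem_nhds hz)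
  · rintro _ ⟨z, hz, rfl⟩
    rwa [hinv hz]
  · rintro _ ⟨z, hz, rfl⟩
    rw [hinv hz]

theorem surjective_fderiv (H : IsOpenDiffeo h k S T) {z : Euc d} (hz : z ∈ S) :
    Function.Surjective (fderiv ℝ h z) :=
  surjective_of_leftInvOn H.isOpen_source H.mapsTo H.invOn.1 hz (H.hasFDerivAt hz)
    ((H.contDiffOn_inv.differentiableOn (by simp)) _ (H.mapsTo hz))

/-- At most one component of `h` has its differential at `z` vanishing on the hyperplane
`v i = 0`. -/
theorem eq_of_fderiv_vanish (H : IsOpenDiffeo h k S T) {z : Euc d} (hz : z ∈ S) {i j j' : Fin d}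
    (hj : ∀ v : Euc d, v i = 0 → fderiv ℝ h z v j = 0)
    (hj' : ∀ v : Euc d, v i = 0 → fderiv ℝ h z v j' = 0) : j = j' := by
  by_contra hne
  obtain ⟨v, hv⟩ := H.surjective_fderiv hz (EuclideanSpace.single j 1)
  obtain ⟨w, hw⟩ := H.surjective_fderiv hz (EuclideanSpace.single j' 1)
  -- This combination lies in the hyperplane, and component `j'` of its image is `-v i`. So `v i =
  -- 0`, which contradicts component `j` of the image of `v` being `1`.
  have hvw : (w i • v - v i • w) i = 0 := by simp [mul_comm]
  have e := hj' _ hvw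
  simp [hv, hw, Ne.symm hne] at e
  have e' := hj v e
  simp [hv] at e'

end IsOpenDiffeo

/-! ### Slices of open sets -/

section Slice

variable {d : ℕ} {S : Set (Euc d)}

theorem eventually_add_smul_mem (hS : IsOpen S) {z : Euc d} (hz : z ∈ S) (v : Euc d) :
    ∀ᶠ t : ℝ in 𝓝 0, z + t • v ∈ S := by
  have hc : ContinuousAt (fun t : ℝ => z + t • v) 0 := by fun_prop
  exact hc.eventually_mem (hS.mem_nhds (by simpa using hz))

theorem exists_pos_add_sub_mem (hS : IsOpen S) {z : Euc d} (hz : z ∈ S) (v : Euc d) :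
    ∃ t : ℝ, 0 < t ∧ z + t • v ∈ S ∧ z + (-t) • v ∈ S := by
  obtain ⟨ε, hε, hball⟩ := Metric.eventually_nhds_iff.1 (eventually_add_smul_mem hS hz v)
  refine ⟨ε / 2, by positivity, hball ?_, hball ?_⟩ <;>
    simp [abs_of_pos hε, hε]

theorem exists_mem_lt_of_slice (hS : IsOpen S) {i : Fin d} {τ : ℝ} (hne : (slice S i τ).Nonempty) :
    ∃ z ∈ S, z i < τ := by
  obtain ⟨z, hz, rfl⟩ := hne
  obtain ⟨t, ht, -, hm⟩ := exists_pos_add_sub_mem hS hz (EuclideanSpace.single i 1)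
  exact ⟨_, hm, by simpa using ht⟩

theorem exists_mem_gt_of_slice (hS : IsOpen S) {i : Fin d} {τ : ℝ} (hne : (slice S i τ).Nonempty) :
    ∃ z ∈ S, τ < z i := by
  obtain ⟨z, hz, rfl⟩ := hne
  obtain ⟨t, ht, hm, -⟩ := exists_pos_add_sub_mem hS hz (EuclideanSpace.single i 1)
  exact ⟨_, hm, by simpa using ht⟩

/-- In an open set a point of a slice can be moved slightly along any other axis without leaving the
slice, so only coordinate `i` is constant there. -/
theorem eq_of_slice_subset (hS : IsOpen S) {i j : Fin d} {τ ρ : ℝ} (hne : (slice S i τ).Nonempty)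
    (hsub : slice S i τ ⊆ slice S j ρ) : i = j ∧ τ = ρ := by
  obtain ⟨z, hz⟩ := hne
  have hij : i = j := by
    by_contra hij
    obtain ⟨t, ht, hm, -⟩ := exists_pos_add_sub_mem hS hz.1 (EuclideanSpace.single j 1)
    have h1 := (hsub ⟨hm, by simp [hij, hz.2]⟩ : _ ∧ _).2
    have h2 := (hsub hz).2
    simp [h2] at h1
    exact ht.ne' h1
  subst hij
  exact ⟨rfl, hz.2.symm.trans (hsub hz).2⟩

theorem isLocallyClosed_slice (hS : IsOpen S) (i : Fin d) (τ : ℝ) :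
    IsLocallyClosed (slice S i τ) := by
  have : IsClosed {z : Euc d | z i = τ} :=
    isClosed_eq (EuclideanSpace.proj (𝕜 := ℝ) i).continuous continuous_const
  exact hS.isLocallyClosed.inter this.isLocallyClosed

end Slice

/-- A finite cover of a connected space by pairwise disjoint closed sets is trivial. -/
theorem exists_eq_univ_of_disjoint_closed_cover {X ι : Type*} [TopologicalSpace X]
    [ConnectedSpace X] [Finite ι] {F : ι → Set X} (hF : ∀ a, IsClosed (F a))
    (hdisj : ∀ a b x, x ∈ F a → x ∈ F b → a = b) (hcov : ∀ x, ∃ a, x ∈ F a) :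
    ∃ a, F a = univ := by
  obtain ⟨x⟩ := (inferInstance : Nonempty X)
  obtain ⟨a, ha⟩ := hcov x
  have hcompl : (F a)ᶜ = ⋃ b : {b // b ≠ a}, F b := by
    ext y
    simp only [mem_compl_iff, mem_iUnion, Subtype.exists, exists_prop]
    constructor
    · intro hy
      obtain ⟨b, hb⟩ := hcov y
      exact ⟨b, fun hba => hy (hba ▸ hb), hb⟩
    · rintro ⟨b, hba, hb⟩ hya
      exact hba (hdisj b a y hb hya)
  have hopen : IsOpen (F a) := by
    rw [← isClosed_compl_iff, hcompl]
    exact isClosed_iUnion_of_finite fun b => hF b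
  exact ⟨a, IsClopen.eq_univ ⟨hF a, hopen⟩ ⟨x, ha⟩⟩

namespace IsOpenDiffeo

variable {d : ℕ} {h k : Euc d → Euc d} {S T : Set (Euc d)}

/-- If `h j` is constant on a slice near `z`, its differential at `z` vanishes along the slice. -/
theorem fderiv_vanish_of_eventually_eq (H : IsOpenDiffeo h k S T) {i j : Fin d} {τ c : ℝ}
    {z : Euc d} (hz : z ∈ slice S i τ) (hc : ∀ᶠ w in 𝓝[slice S i τ] z, h w j = c)
    {v : Euc d} (hv : v i = 0) : fderiv ℝ h z v j = 0 := by
  have hline : Tendsto (fun t : ℝ => z + t • v) (𝓝 0) (𝓝[slice S i τ] z) := by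
    refine tendsto_nhdsWithin_iff.2 ⟨?_, ?_⟩
    · have : ContinuousAt (fun t : ℝ => z + t • v) 0 := by fun_prop
      simpa [ContinuousAt] using this
    · filter_upwards [eventually_add_smul_mem H.isOpen_source hz.1 v] with t ht
      exact ⟨ht, by simp [hv, hz.2]⟩
  have hd : HasDerivAt (fun t : ℝ => h (z + t • v)) (fderiv ℝ h z v) 0 := by
    have hl : HasDerivAt (fun t : ℝ => z + t • v) v 0 := by
      simpa using ((hasDerivAt_id (0 : ℝ)).smul_const v).const_add z
    have hz' : HasFDerivAt h (fderiv ℝ h z) (z + (0 : ℝ) • v) := by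
      simpa using H.hasFDerivAt hz.1
    exact hz'.comp_hasDerivAt 0 hl
  have hdj : HasDerivAt (fun t : ℝ => h (z + t • v) j) (fderiv ℝ h z v j) 0 :=
    (EuclideanSpace.proj (𝕜 := ℝ) j).hasFDerivAt.comp_hasDerivAt 0 hd
  have hconst : HasDerivAt (fun t : ℝ => h (z + t • v) j) 0 0 :=
    (hasDerivAt_const 0 c).congr_of_eventuallyEq (hline.eventually hc)
  exact hdj.unique hconst

/-- A connected slice that a diffeomorphism maps into a grid is mapped into one slice of the
grid. -/
theorem exists_mapsTo_slice (H : IsOpenDiffeo h k S T) (B : DiscreteCoordination d) {i : Fin d}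
    {τ : ℝ} (hconn : IsConnected (slice S i τ)) (hgrid : MapsTo h (slice S i τ) (gridSet T B)) :
    ∃ j l, MapsTo h (slice S i τ) (slice T j (B.thr j l)) := by
  have : ConnectedSpace (slice S i τ) := isConnected_iff_connectedSpace.1 hconn
  -- Local compactness makes the slice a Baire space.
  have : LocallyCompactSpace (slice S i τ) :=
    (isLocallyClosed_slice H.isOpen_source i τ).locallyCompactSpace
  have hcont (j : Fin d) : Continuous fun z : slice S i τ => h z j :=
    (H.continuousOn_apply j).comp_continuous continuous_subtype_val fun z => z.2.1
  -- The sets `E a` cover the slice but may overlap where slices of the target cross; intersecting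
  -- with the first-order condition `V` makes them disjoint.
  let E : (Σ j, Fin (B.size j)) → Set (slice S i τ) := fun a => {z | h z a.1 = B.thr a.1 a.2}
  let V : Fin d → Set (slice S i τ) := fun j =>
    {z | ∀ v : Euc d, v i = 0 → fderiv ℝ h z v j = 0}
  have hE (a) : IsClosed (E a) := isClosed_eq (hcont a.1) continuous_const
  have hV (j) : IsClosed (V j) := by
    simp only [V, ofPred_forall]
    refine isClosed_iInter fun v => isClosed_iInter fun _ => isClosed_eq ?_ continuous_const
    have h1 : Continuous fun z : slice S i τ => fderiv ℝ h z :=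
      H.continuousOn_fderiv.comp_continuous continuous_subtype_val fun z => z.2.1
    exact (EuclideanSpace.proj (𝕜 := ℝ) j).continuous.comp (h1.clm_apply continuous_const)
  have hEcov : ⋃ a, E a = univ := by
    refine eq_univ_of_forall fun z => ?_
    obtain ⟨j, l, hjl⟩ : ∃ j l, h z ∈ slice T j (B.thr j l) := by
      simpa [gridSet] using hgrid z.2
    exact mem_iUnion.2 ⟨⟨j, l⟩, hjl.2⟩
  have hsub (a) : interior (E a) ⊆ V a.1 := by
    intro z hz v hv
    refine H.fderiv_vanish_of_eventually_eq (c := B.thr a.1 a.2) z.2 ?_ hv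
    rw [← eventually_nhds_subtype_iff]
    exact mem_interior_iff_mem_nhds.1 hz
  -- By Baire the interiors of the `E a` have dense union; the sets `E a ∩ V a.1` contain them and
  -- have closed union.
  have hcov (z) : ∃ a, z ∈ E a ∩ V a.1 := by
    have hd : Dense (⋃ a, interior (E a)) := dense_iUnion_interior_of_closed hE hEcov
    have hc : IsClosed (⋃ a, E a ∩ V a.1) :=
      isClosed_iUnion_of_finite fun a => (hE a).inter (hV a.1)
    have := closure_minimal (iUnion_mono fun a =>
      subset_inter interior_subset (hsub a)) hc (hd z)
    simpa using this
  obtain ⟨a, ha⟩ := exists_eq_univ_of_disjoint_closed_cover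
    (F := fun a => E a ∩ V a.1) (fun a => (hE a).inter (hV a.1)) (by
      rintro ⟨j, l⟩ ⟨j', l'⟩ z ⟨hz, hzV⟩ ⟨hz', hzV'⟩
      obtain rfl : j = j' := H.eq_of_fderiv_vanish z.2.1 hzV hzV'
      obtain rfl : l = l' := (B.strictMono j).injective (hz.symm.trans hz')
      rfl) hcov
  refine ⟨a.1, a.2, fun z hz => ⟨H.mapsTo hz.1, ?_⟩⟩
  exact (ha.ge (mem_univ (⟨z, hz⟩ : slice S i τ))).1

end IsOpenDiffeo

/-! ### Densities under diffeomorphisms -/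

theorem ae_mem_support_withDensity {d : ℕ} {p : Euc d → ℝ} (hp : Measurable p) :
    ∀ᵐ z ∂(volume.withDensity fun z => ENNReal.ofReal (p z)), z ∈ Function.support p := by
  rw [ae_withDensity_iff hp.ennreal_ofReal]
  refine Eventually.of_forall fun z hz hzp => hz ?_
  simp [hzp]

theorem IsPDFOf.ae_mem_support {Ω : Type*} [MeasurableSpace Ω] {P : Measure Ω} {d : ℕ}
    {p : Euc d → ℝ} {Z : Ω → Euc d} (hp : IsPDFOf p Z P) (hZ : Measurable Z) :
    ∀ᵐ ω ∂P, Z ω ∈ Function.support p := by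
  have := ae_mem_support_withDensity hp.measurable
  rw [← hp.map_eq] at this
  exact ae_of_ae_map hZ.aemeasurable this

/-- Discontinuity of `p` itself is absorbed, since `p` belongs to its own class. Apart from the
support, the condition then depends only on the measure and can be transported. -/
theorem mem_nonRemovableDiscontinuities_iff {d : ℕ} {p : Euc d → ℝ} (hp : Measurable p)
    (hp0 : ∀ z, 0 ≤ p z) {z : Euc d} :
    z ∈ nonRemovableDiscontinuities p ↔
      z ∈ Function.support p ∧ ∀ q, SameDistribution p q → ¬ ContinuousAt q z := by
  refine and_congr_right fun _ => ⟨?_, ?_⟩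
  · rintro ⟨h1, h2⟩ q hq hqc
    exact h2 ⟨h1, q, hq, hqc⟩
  · intro h
    refine ⟨h p ⟨hp, hp0, rfl⟩, ?_⟩
    rintro ⟨-, q, hq, hqc⟩
    exact h q hq hqc

namespace IsOpenDiffeo

variable {d : ℕ} {h k : Euc d → Euc d} {S T : Set (Euc d)}

theorem measurableSet_preimage_inter (H : IsOpenDiffeo h k S T) {E : Set (Euc d)}
    (hE : MeasurableSet E) : MeasurableSet (h ⁻¹' E ∩ S) := by
  have hm : Measurable (S.domRestrict h) := H.continuousOn.domRestrict.measurable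
  have := H.isOpen_source.measurableSet.subtype_image (hm hE)
  convert this using 1
  ext z
  simp [and_comm]

theorem image_inv_inter (H : IsOpenDiffeo h k S T) (E : Set (Euc d)) :
    k '' (E ∩ T) = h ⁻¹' E ∩ S := by
  ext z
  constructor
  · rintro ⟨y, ⟨hyE, hyT⟩, rfl⟩
    exact ⟨by simpa [H.right_inv hyT] using hyE, H.mapsTo_inv hyT⟩
  · rintro ⟨hzE, hzS⟩
    exact ⟨h z, ⟨hzE, H.mapsTo hzS⟩, H.left_inv hzS⟩

/-- The density of the image under `h` of a measure with density `q`, by change of variables. -/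
noncomputable def pushDensity (k : Euc d → Euc d) (T : Set (Euc d)) (q : Euc d → ℝ) :
    Euc d → ℝ :=
  T.indicator fun y => |(fderiv ℝ k y).det| * q (k y)

theorem measurable_pushDensity (H : IsOpenDiffeo h k S T) {q : Euc d → ℝ} (hq : Measurable q) :
    Measurable (pushDensity k T q) := by
  refine measurable_of_restrict_of_restrict_compl H.isOpen_target.measurableSet ?_ ?_
  · have hk : Measurable (T.domRestrict k) := H.symm.continuousOn.domRestrict.measurable
    have hd : Measurable fun y : T => |(fderiv ℝ k y).det| :=
      (continuous_abs.comp (ContinuousLinearMap.continuous_det.comp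
        H.symm.continuousOn_fderiv.domRestrict)).measurable
    have : T.domRestrict (pushDensity k T q) = fun y : T => |(fderiv ℝ k y).det| * q (k y) := by
      funext y
      simp [pushDensity]
    rw [this]
    exact hd.mul (hq.comp hk)
  · have : Tᶜ.domRestrict (pushDensity k T q) = fun _ => 0 := by
      funext y
      simp [pushDensity, show (y : Euc d) ∉ T from y.2]
    rw [this]
    exact measurable_const

/-- Change of variables for the injective map `k` on `E ∩ T`, whose image is `h ⁻¹' E ∩ S`. -/
theorem withDensity_pushDensity_apply (H : IsOpenDiffeo h k S T) {q : Euc d → ℝ}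
    {E : Set (Euc d)} (hE : MeasurableSet E) :
    (volume.withDensity fun y => ENNReal.ofReal (pushDensity k T q y)) E =
      (volume.withDensity fun z => ENNReal.ofReal (q z)) (h ⁻¹' E ∩ S) := by
  have hT := H.isOpen_target.measurableSet
  have hind : (fun y => ENNReal.ofReal (pushDensity k T q y)) =
      T.indicator fun y => ENNReal.ofReal |(fderiv ℝ k y).det| * ENNReal.ofReal (q (k y)) := by
    funext y
    by_cases hy : y ∈ T
    · simp [pushDensity, hy, ENNReal.ofReal_mul]
    · simp [pushDensity, hy]
  have hcv := lintegral_image_eq_lintegral_abs_det_fderiv_mul volume (hE.inter hT)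
    (fun y hy => (H.symm.hasFDerivAt hy.2).hasFDerivWithinAt)
    (H.invOn.2.injOn.mono inter_subset_right) fun z => ENNReal.ofReal (q z)
  rw [withDensity_apply' _ E, withDensity_apply', hind, lintegral_indicator hT,
    Measure.restrict_restrict hT, inter_comm T E, ← hcv, H.image_inv_inter]

theorem continuousAt_pushDensity (H : IsOpenDiffeo h k S T) {q : Euc d → ℝ} {z : Euc d}
    (hz : z ∈ S) (hq : ContinuousAt q z) : ContinuousAt (pushDensity k T q) (h z) := by
  have hT := H.isOpen_target.mem_nhds (H.mapsTo hz)
  have hk : ContinuousAt k (h z) := H.symm.continuousOn.continuousAt hT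
  have hd : ContinuousAt (fun y => |(fderiv ℝ k y).det|) (h z) :=
    continuous_abs.continuousAt.comp (ContinuousLinearMap.continuous_det.continuousAt.comp
      (H.symm.continuousOn_fderiv.continuousAt hT))
  have hqk : ContinuousAt (fun y => q (k y)) (h z) :=
    ContinuousAt.comp (g := q) (by rwa [H.left_inv hz]) hk
  refine (hd.mul hqk).congr ?_
  filter_upwards [hT] with y hy
  simp [pushDensity, hy]

/-- By contraposition: a version of `p'` continuous at `h z` pulls back to a version of `p`
continuous at `z`. -/
theorem map_mem_nonRemovableDiscontinuities (H : IsOpenDiffeo h k S T) {p p' : Euc d → ℝ}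
    (hp : Measurable p) (hp0 : ∀ z, 0 ≤ p z) (hp' : Measurable p') (hp0' : ∀ z, 0 ≤ p' z)
    (hS : Function.support p = S) (hT : Function.support p' = T)
    (hpp' : ∀ E, MeasurableSet E → (volume.withDensity fun z => ENNReal.ofReal (p z)) E =
      (volume.withDensity fun z => ENNReal.ofReal (p' z)) (k ⁻¹' E ∩ T))
    {z : Euc d} (hz : z ∈ nonRemovableDiscontinuities p) :
    h z ∈ nonRemovableDiscontinuities p' := by
  rw [mem_nonRemovableDiscontinuities_iff hp hp0] at hz
  rw [mem_nonRemovableDiscontinuities_iff hp' hp0']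
  have hzS : z ∈ S := hS ▸ hz.1
  refine ⟨hT ▸ H.mapsTo hzS, fun q hq hqc => ?_⟩
  refine hz.2 (pushDensity h S q) ⟨H.symm.measurable_pushDensity hq.1, fun w => ?_, ?_⟩ ?_
  · exact indicator_nonneg (fun w _ => mul_nonneg (abs_nonneg _) (hq.2.1 _)) w
  · ext E hE
    rw [H.symm.withDensity_pushDensity_apply hE, hq.2.2, hpp' E hE]
  · simpa [H.left_inv hzS] using H.symm.continuousAt_pushDensity (H.mapsTo hzS) hqc

/-- The non-removable discontinuities of the densities of `Z` and `h Z` correspond under `h`. -/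
theorem mapsTo_nonRemovableDiscontinuities {Ω : Type*} [MeasurableSpace Ω] {P : Measure Ω}
    (H : IsOpenDiffeo h k S T) {Z : Ω → Euc d} (hZ : Measurable Z) {p p' : Euc d → ℝ}
    (hp : IsPDFOf p Z P) (hp' : IsPDFOf p' (fun ω => h (Z ω)) P)
    (hS : Function.support p = S) (hT : Function.support p' = T) :
    MapsTo h (nonRemovableDiscontinuities p) (nonRemovableDiscontinuities p') ∧
      MapsTo k (nonRemovableDiscontinuities p') (nonRemovableDiscontinuities p) := by
  have hae : ∀ᵐ z ∂(volume.withDensity fun z => ENNReal.ofReal (p z)), z ∈ S :=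
    hS ▸ ae_mem_support_withDensity hp.measurable
  -- Off `S` the map `h` is arbitrary, but the law of `Z` is carried by `S`.
  have hhm : AEMeasurable h (P.map Z) := by
    rw [hp.map_eq, ← Measure.restrict_eq_self_of_ae_mem hae]
    exact H.continuousOn.aemeasurable H.isOpen_source.measurableSet
  have hfwd (E : Set (Euc d)) (hE : MeasurableSet E) :
      (volume.withDensity fun z => ENNReal.ofReal (p' z)) E =
        (volume.withDensity fun z => ENNReal.ofReal (p z)) (h ⁻¹' E ∩ S) := by
    have hmap : P.map (fun ω => h (Z ω)) = (P.map Z).map h :=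
      (AEMeasurable.map_map_of_aemeasurable hhm hZ.aemeasurable).symm
    rw [← hp'.map_eq, hmap, Measure.map_apply_of_aemeasurable hhm hE, hp.map_eq]
    refine measure_congr ?_
    filter_upwards [hae] with z hz
    exact propext ⟨fun hzE => ⟨hzE, hz⟩, fun hzE => hzE.1⟩
  have hbwd (E : Set (Euc d)) (hE : MeasurableSet E) :
      (volume.withDensity fun z => ENNReal.ofReal (p z)) E =
        (volume.withDensity fun z => ENNReal.ofReal (p' z)) (k ⁻¹' E ∩ T) := by
    rw [hfwd _ (H.symm.measurableSet_preimage_inter hE)]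
    refine measure_congr ?_
    filter_upwards [hae] with z hz
    refine propext ⟨fun hzE => ⟨⟨?_, H.mapsTo hz⟩, hz⟩, fun hzE => ?_⟩
    · rwa [mem_preimage, H.left_inv hz]
    · have := hzE.1.1
      rwa [mem_preimage, H.left_inv hz] at this
  exact ⟨fun z hz => H.map_mem_nonRemovableDiscontinuities hp.measurable hp.nonneg hp'.measurable
      hp'.nonneg hS hT hbwd hz,
    fun z hz => H.symm.map_mem_nonRemovableDiscontinuities hp'.measurable hp'.nonneg hp.measurable
      hp.nonneg hT hS hfwd hz⟩

end IsOpenDiffeo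

/-! ### Sides of an axis-separator -/

section Sides

variable {d : ℕ} {S : Set (Euc d)}

theorem IsPreconnected.forall_lt_or_forall_gt {X : Type*} [TopologicalSpace X] {K : Set X}
    (hK : IsPreconnected K) {u : X → ℝ} (hu : ContinuousOn u K) {c : ℝ} (hc : ∀ x ∈ K, u x ≠ c) :
    (∀ x ∈ K, u x < c) ∨ ∀ x ∈ K, c < u x := by
  by_contra! hcon
  obtain ⟨⟨x, hx, hxc⟩, y, hy, hyc⟩ := hcon
  obtain ⟨w, hw, hwc⟩ := hK.intermediate_value hy hx hu ⟨hyc, hxc⟩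
  exact hc w hw hwc

theorem continuousOn_apply_self (i : Fin d) (K : Set (Euc d)) : ContinuousOn (fun z => z i) K :=
  (EuclideanSpace.proj (𝕜 := ℝ) i).continuous.continuousOn

theorem apply_ne_of_mem_connectedComponentIn {i : Fin d} {τ : ℝ} {a z : Euc d}
    (hz : z ∈ connectedComponentIn (S \ slice S i τ) a) : z i ≠ τ := by
  have := connectedComponentIn_subset _ _ hz
  exact fun h => this.2 ⟨this.1, h⟩

theorem IsAxisSeparator.nonempty {i : Fin d} {τ : ℝ} (h : IsAxisSeparator S i τ) :
    (slice S i τ).Nonempty :=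
  h.2.1.nonempty

/-- Both sides of an axis-separator are connected. -/
theorem IsAxisSeparator.isPreconnected_sides (hS : IsOpen S) {i : Fin d} {τ : ℝ}
    (hsep : IsAxisSeparator S i τ) :
    IsPreconnected {z | z ∈ S ∧ z i < τ} ∧ IsPreconnected {z | z ∈ S ∧ τ < z i} := by
  obtain ⟨a, haS, ha⟩ := exists_mem_lt_of_slice hS hsep.nonempty
  obtain ⟨b, hbS, hb⟩ := exists_mem_gt_of_slice hS hsep.nonempty
  set C : Euc d → Set (Euc d) := connectedComponentIn (S \ slice S i τ)
  have hmem {z : Euc d} (hz : z ∈ S) (hne : z i ≠ τ) : z ∈ S \ slice S i τ :=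
    ⟨hz, fun h => hne h.2⟩
  have hself {z : Euc d} (hz : z ∈ S) (hne : z i ≠ τ) : z ∈ C z :=
    mem_connectedComponentIn (hmem hz hne)
  have hside (z : Euc d) := IsPreconnected.forall_lt_or_forall_gt
    (isPreconnected_connectedComponentIn (F := S \ slice S i τ) (x := z))
    (continuousOn_apply_self i _) fun w hw => apply_ne_of_mem_connectedComponentIn hw
  have hlt {z : Euc d} (hz : z ∈ S) (hzτ : z i < τ) : ∀ w ∈ C z, w i < τ :=
    (hside z).resolve_right fun h => (h z (hself hz hzτ.ne)).not_gt hzτ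
  have hgt {z : Euc d} (hz : z ∈ S) (hzτ : τ < z i) : ∀ w ∈ C z, τ < w i :=
    (hside z).resolve_left fun h => (h z (hself hz hzτ.ne')).not_gt hzτ
  -- The components of `a` and `b` lie on opposite sides, so they are the only two, and each fills
  -- its side.
  obtain ⟨K, K', -, hsplit⟩ := encard_eq_two.1 hsep.2.2
  have hsp {z : Euc d} (hz : z ∈ S) (hne : z i ≠ τ) : C z = K ∨ C z = K' := by
    have : C z ∈ splitting S (slice S i τ) := ⟨z, hmem hz hne, rfl⟩
    simpa [hsplit] using this
  have hCab : C a ≠ C b := fun h =>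
    (hlt haS ha b (h ▸ hself hbS hb.ne')).not_gt hb
  have hCor {z : Euc d} (hz : z ∈ S) (hne : z i ≠ τ) : C z = C a ∨ C z = C b := by
    have h1 := hsp haS ha.ne
    have h2 := hsp hbS hb.ne'
    have h3 := hsp hz hne
    grind
  constructor
  · have : {z | z ∈ S ∧ z i < τ} = C a := by
      ext z
      constructor
      · rintro ⟨hz, hzτ⟩
        rcases hCor hz hzτ.ne with h | h
        · exact h ▸ hself hz hzτ.ne
        · exact absurd (hgt hbS hb z (h ▸ hself hz hzτ.ne)) hzτ.not_gt
      · exact fun hz => ⟨(connectedComponentIn_subset _ _ hz).1, hlt haS ha z hz⟩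
    rw [this]
    exact isPreconnected_connectedComponentIn
  · have : {z | z ∈ S ∧ τ < z i} = C b := by
      ext z
      constructor
      · rintro ⟨hz, hzτ⟩
        rcases hCor hz hzτ.ne' with h | h
        · exact absurd (hlt haS ha z (h ▸ hself hz hzτ.ne')) hzτ.not_gt
        · exact h ▸ hself hz hzτ.ne'
      · exact fun hz => ⟨(connectedComponentIn_subset _ _ hz).1, hgt hbS hb z hz⟩
    rw [this]
    exact isPreconnected_connectedComponentIn

end Sides

/-! ### Matching of slices -/

namespace IsOpenDiffeo

variable {d : ℕ} {h k : Euc d → Euc d} {S T : Set (Euc d)}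

/-- `h` maps the slice `z i = τ` of `S` onto the slice `y j = ρ` of its image. -/
def SlicesMatch (h : Euc d → Euc d) (S : Set (Euc d)) (i : Fin d) (τ : ℝ) (j : Fin d) (ρ : ℝ) :
    Prop :=
  ∀ z ∈ S, z i = τ ↔ h z j = ρ

/-- The slice goes into one target slice, which `k` sends back into one source slice. The round trip
is an inclusion of slices, hence an equality, so nothing else reaches the target slice. -/
theorem exists_slicesMatch (H : IsOpenDiffeo h k S T) {A B : DiscreteCoordination d}
    (hA : ∀ i l, IsAxisSeparator S i (A.thr i l)) (hB : ∀ j l, IsAxisSeparator T j (B.thr j l))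
    (hAB : MapsTo h (gridSet S A) (gridSet T B)) (hBA : MapsTo k (gridSet T B) (gridSet S A))
    (i : Fin d) (m : Fin (A.size i)) :
    ∃ j l, SlicesMatch h S i (A.thr i m) j (B.thr j l) := by
  have hsubA (i m) : slice S i (A.thr i m) ⊆ gridSet S A :=
    subset_iUnion₂ (s := fun i m => slice S i (A.thr i m)) i m
  have hsubB (j l) : slice T j (B.thr j l) ⊆ gridSet T B :=
    subset_iUnion₂ (s := fun j l => slice T j (B.thr j l)) j l
  obtain ⟨j, l, hjl⟩ := H.exists_mapsTo_slice B (hA i m).2.1 (hAB.mono_left (hsubA i m))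
  obtain ⟨i', m', him'⟩ := H.symm.exists_mapsTo_slice A (hB j l).2.1 (hBA.mono_left (hsubB j l))
  have hsub : slice S i (A.thr i m) ⊆ slice S i' (A.thr i' m') := fun z hz => by
    simpa [H.left_inv hz.1] using him' (hjl hz)
  obtain ⟨rfl, hthr⟩ := eq_of_slice_subset H.isOpen_source (hA i m).nonempty hsub
  refine ⟨j, l, fun z hz => ⟨fun hzi => (hjl ⟨hz, hzi⟩).2, fun hzj => ?_⟩⟩
  have := (him' (x := h z) ⟨H.mapsTo hz, hzj⟩).2
  rwa [H.left_inv hz, ← hthr] at this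

theorem SlicesMatch.symm (H : IsOpenDiffeo h k S T) {i j : Fin d} {τ ρ : ℝ}
    (hm : SlicesMatch k T j ρ i τ) : SlicesMatch h S i τ j ρ := fun z hz => by
  simpa [H.left_inv hz] using (hm (h z) (H.mapsTo hz)).symm

theorem SlicesMatch.source_unique (hS : IsOpen S) {i i' j : Fin d} {τ τ' ρ : ℝ}
    (hne : (slice S i τ).Nonempty) (h1 : SlicesMatch h S i τ j ρ)
    (h2 : SlicesMatch h S i' τ' j ρ) : i = i' ∧ τ = τ' :=
  eq_of_slice_subset hS hne fun z hz => ⟨hz.1, (h2 z hz.1).2 ((h1 z hz.1).1 hz.2)⟩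

theorem SlicesMatch.target_unique (H : IsOpenDiffeo h k S T) {i j j' : Fin d} {τ ρ ρ' : ℝ}
    (hne : (slice T j ρ).Nonempty) (h1 : SlicesMatch h S i τ j ρ)
    (h2 : SlicesMatch h S i τ j' ρ') : j = j' ∧ ρ = ρ' := by
  refine eq_of_slice_subset H.isOpen_target hne fun y hy => ⟨hy.1, ?_⟩
  have hyS := H.mapsTo_inv hy.1
  rw [← H.right_inv hy.1]
  refine (h2 _ hyS).1 ((h1 _ hyS).2 ?_)
  rw [H.right_inv hy.1]
  exact hy.2

/-- Backbone separators share a point, so their images lie on distinct axes, and all axes are used.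
Any other separator on axis `i` crosses the backbone separators of the other axes, which leaves only
axis `σ i` for its image. -/
theorem exists_axis_perm (H : IsOpenDiffeo h k S T) {A B : DiscreteCoordination d}
    (hA : ∀ i l, IsAxisSeparator S i (A.thr i l))
    (hmatch : ∀ i m, ∃ j l, SlicesMatch h S i (A.thr i m) j (B.thr j l))
    (hbb : HasBackbone S A) :
    ∃ σ : Equiv.Perm (Fin d), ∀ i m, ∃ l, SlicesMatch h S i (A.thr i m) (σ i) (B.thr (σ i) l) := by
  obtain ⟨c, ⟨z, hz⟩, hcross⟩ := hbb
  have hzc (i) : z ∈ slice S i (A.thr i (c i)) := mem_iInter.1 (hz.ge rfl) i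
  choose τ l hτ using fun i => hmatch i (c i)
  have axis_ne {i i' j : Fin d} (hii' : i ≠ i') (m : Fin (A.size i)) (m' : Fin (A.size i'))
      {l l' : Fin (B.size j)}
      (h1 : SlicesMatch h S i (A.thr i m) j (B.thr j l))
      (h2 : SlicesMatch h S i' (A.thr i' m') j (B.thr j l'))
      (hne : (slice S i (A.thr i m) ∩ slice S i' (A.thr i' m')).Nonempty) : False := by
    obtain ⟨w, hw, hw'⟩ := hne
    have he : B.thr j l = B.thr j l' :=
      ((h1 w hw.1).1 hw.2).symm.trans ((h2 w hw.1).1 hw'.2)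
    rw [← he] at h2
    exact hii' (h1.source_unique H.isOpen_source (hA i m).nonempty h2).1
  have hinj : Function.Injective τ := by
    intro i i' hii'
    by_contra hne
    have h2 := hτ i'
    -- The type of `l i'` depends on `τ i'`, so it is generalized before rewriting the axis.
    generalize l i' = l' at h2
    revert l' h2
    rw [← hii']
    intro l' h2
    exact axis_ne hne _ _ (hτ i) h2 ⟨z, hzc i, hzc i'⟩
  refine ⟨Equiv.ofBijective τ (Finite.injective_iff_bijective.1 hinj), fun i m => ?_⟩
  obtain ⟨j, l', hj⟩ := hmatch i m
  obtain ⟨i', rfl⟩ := (Finite.injective_iff_surjective.1 hinj) j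
  by_cases hii' : i = i'
  · subst hii'
    exact ⟨l', hj⟩
  · exact (axis_ne (Ne.symm hii') _ _ (hτ i') hj (hcross i' i hii' m)).elim

/-- A diffeomorphism that matches two axis-separators preserves or exchanges their sides. -/
theorem SlicesMatch.sides (H : IsOpenDiffeo h k S T) {i j : Fin d} {τ ρ : ℝ}
    (hsep : IsAxisSeparator S i τ) (hm : SlicesMatch h S i τ j ρ) :
    (∀ z ∈ S, τ ≤ z i ↔ ρ ≤ h z j) ∨ ∀ z ∈ S, τ ≤ z i ↔ h z j ≤ ρ := by
  obtain ⟨hL, hR⟩ := hsep.isPreconnected_sides H.isOpen_source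
  have hneT : (slice T j ρ).Nonempty := by
    obtain ⟨z, hz, hzi⟩ := hsep.nonempty
    exact ⟨h z, H.mapsTo hz, (hm z hz).1 hzi⟩
  -- Points of `T` on either side of `ρ` exclude that both sides of the source land on the same
  -- side.
  obtain ⟨y, hyT, hy⟩ := exists_mem_lt_of_slice H.isOpen_target hneT
  obtain ⟨y', hyT', hy'⟩ := exists_mem_gt_of_slice H.isOpen_target hneT
  have hyS := H.mapsTo_inv hyT
  have hyS' := H.mapsTo_inv hyT'
  rw [← H.right_inv hyT] at hy
  rw [← H.right_inv hyT'] at hy'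
  have h1 := IsPreconnected.forall_lt_or_forall_gt hL
    ((H.continuousOn_apply j).mono fun z hz => hz.1) (c := ρ)
    fun z hz he => hz.2.ne ((hm z hz.1).2 he)
  have h2 := IsPreconnected.forall_lt_or_forall_gt hR
    ((H.continuousOn_apply j).mono fun z hz => hz.1) (c := ρ)
    fun z hz he => hz.2.ne' ((hm z hz.1).2 he)
  have hL' {P : Euc d → Prop} (h : ∀ z ∈ {z | z ∈ S ∧ z i < τ}, P z) (z) (hz : z ∈ S)
    (hzi : z i < τ) : P z := h z ⟨hz, hzi⟩
  have hR' {P : Euc d → Prop} (h : ∀ z ∈ {z | z ∈ S ∧ τ < z i}, P z) (z) (hz : z ∈ S)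
    (hzi : τ < z i) : P z := h z ⟨hz, hzi⟩
  rcases h1 with h1 | h1 <;> rcases h2 with h2 | h2 <;>
    replace h1 := hL' h1 <;> replace h2 := hR' h2
  · rcases lt_trichotomy (k y' i) τ with h3 | h3 | h3
    · exact absurd (h1 _ hyS' h3) hy'.not_gt
    · exact absurd ((hm _ hyS').1 h3) hy'.ne'
    · exact absurd (h2 _ hyS' h3) hy'.not_gt
  · left
    intro z hz
    rcases lt_trichotomy (z i) τ with h3 | h3 | h3
    · exact iff_of_false h3.not_ge (h1 z hz h3).not_ge
    · simp [h3, (hm z hz).1 h3]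
    · simp [h3.le, (h2 z hz h3).le]
  · right
    intro z hz
    rcases lt_trichotomy (z i) τ with h3 | h3 | h3
    · exact iff_of_false h3.not_ge (h1 z hz h3).not_ge
    · simp [h3, (hm z hz).1 h3]
    · simp [h3.le, (h2 z hz h3).le]
  · rcases lt_trichotomy (k y i) τ with h3 | h3 | h3
    · exact absurd (h1 _ hyS h3) hy.not_gt
    · exact absurd ((hm _ hyS).1 h3) hy.ne
    · exact absurd (h2 _ hyS h3) hy.not_gt

/-- Two parallel separators cannot be matched with opposite orientations. -/
theorem not_opposite_orientation (H : IsOpenDiffeo h k S T) {i j : Fin d} {τ τ' ρ ρ' : ℝ}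
    (hne : (slice T j ρ).Nonempty) (hne' : (slice T j ρ').Nonempty)
    (h1 : ∀ z ∈ S, τ ≤ z i ↔ ρ ≤ h z j) (h2 : ∀ z ∈ S, τ' ≤ z i ↔ h z j ≤ ρ') : False := by
  have tr {y : Euc d} (hy : y ∈ T) : (τ ≤ k y i ↔ ρ ≤ y j) ∧ (τ' ≤ k y i ↔ y j ≤ ρ') := by
    have e1 := h1 _ (H.mapsTo_inv hy)
    have e2 := h2 _ (H.mapsTo_inv hy)
    rw [H.right_inv hy] at e1 e2
    exact ⟨e1, e2⟩
  -- If `τ ≤ τ'`, then `y j ≤ ρ'` forces `ρ ≤ y j` on `T`. A point below `ρ'` gives `ρ < ρ'`, and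
  -- one below `ρ` gives `ρ' < ρ`. The other case is the mirror image, with points above.
  rcases le_total τ τ' with hle | hle
  · obtain ⟨y, hy, hyρ⟩ := exists_mem_lt_of_slice H.isOpen_target hne
    obtain ⟨y', hy', hyρ'⟩ := exists_mem_lt_of_slice H.isOpen_target hne'
    have a1 : ρ ≤ y' j := (tr hy').1.1 (hle.trans ((tr hy').2.2 hyρ'.le))
    have a2 : ρ' < y j := by
      by_contra! hcon
      exact hyρ.not_ge ((tr hy).1.1 (hle.trans ((tr hy).2.2 hcon)))
    linarith
  · obtain ⟨y, hy, hyρ⟩ := exists_mem_gt_of_slice H.isOpen_target hne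
    obtain ⟨y', hy', hyρ'⟩ := exists_mem_gt_of_slice H.isOpen_target hne'
    have a1 : y j ≤ ρ' := (tr hy).2.1 (hle.trans ((tr hy).1.2 hyρ.le))
    have a2 : y' j < ρ := by
      by_contra! hcon
      exact hyρ'.not_ge ((tr hy').2.1 (hle.trans ((tr hy').1.2 hcon)))
    linarith

/-- A diffeomorphism between axis-aligned grids, the first of which has a backbone, preserves
quantized coordinates up to a permutation of the axes and reversals. -/
theorem exists_quantizeSign_eq (H : IsOpenDiffeo h k S T) {A B : DiscreteCoordination d}
    (hA : ∀ i l, IsAxisSeparator S i (A.thr i l)) (hB : ∀ j l, IsAxisSeparator T j (B.thr j l))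
    (hAB : MapsTo h (gridSet S A) (gridSet T B)) (hBA : MapsTo k (gridSet T B) (gridSet S A))
    (hbb : HasBackbone S A) :
    ∃ (σ : Equiv.Perm (Fin d)) (s : Fin d → ℤˣ), ∀ z ∈ S, ∀ i,
      quantizeSign (s i) (h z (σ i)) (B.thr (σ i)) = quantize (z i) (A.thr i) := by
  obtain ⟨σ, hσ⟩ := H.exists_axis_perm hA (H.exists_slicesMatch hA hB hAB hBA) hbb
  choose φ hφ using hσ
  have hinj (i) : Function.Injective (φ i) := fun m m' hmm' => by
    have h2 := hφ i m'
    rw [← hmm'] at h2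
    exact (A.strictMono i).injective
      ((hφ i m).source_unique H.isOpen_source (hA i m).nonempty h2).2
  have hsurj (i) : Function.Surjective (φ i) := fun l => by
    obtain ⟨i', m, hm⟩ := H.symm.exists_slicesMatch hB hA hBA hAB (σ i) l
    have hm' := SlicesMatch.symm H hm
    obtain ⟨hσi, hl⟩ := hm'.target_unique H (hB _ _).nonempty (hφ i' m)
    obtain rfl := σ.injective hσi
    exact ⟨m, ((B.strictMono _).injective hl).symm⟩
  have hside (i) : (∀ m, ∀ z ∈ S, A.thr i m ≤ z i ↔ B.thr (σ i) (φ i m) ≤ h z (σ i)) ∨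
      ∀ m, ∀ z ∈ S, A.thr i m ≤ z i ↔ h z (σ i) ≤ B.thr (σ i) (φ i m) := by
    by_contra hcon
    rw [not_or, not_forall, not_forall] at hcon
    obtain ⟨⟨m, hm⟩, m', hm'⟩ := hcon
    have h1 := ((hφ i m).sides H (hA i m)).resolve_left hm
    have h2 := ((hφ i m').sides H (hA i m')).resolve_right hm'
    exact H.not_opposite_orientation (hB _ _).nonempty (hB _ _).nonempty h2 h1
  have hsign (i) : ∃ s : ℤˣ, ∀ z ∈ S,
      quantizeSign s (h z (σ i)) (B.thr (σ i)) = quantize (z i) (A.thr i) := by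
    -- Quantization is a count, so a side-preserving bijection of thresholds suffices, monotone or
    -- not. The weak inequalities also correspond on the separators, so no point of `S` is excluded.
    have hbij : Function.Bijective (φ i) := ⟨hinj i, hsurj i⟩
    rcases hside i with hs | hs
    · refine ⟨1, fun z hz => ?_⟩
      rw [quantizeSign, if_pos rfl, quantize, quantize, ← hbij.sum_comp]
      exact Finset.sum_congr rfl fun m _ => by simp [hs m z hz]
    · refine ⟨-1, fun z hz => ?_⟩
      rw [quantizeSign, if_neg (by decide), quantizeRev, quantize, ← hbij.sum_comp]
      exact Finset.sum_congr rfl fun m _ => by simp [hs m z hz]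
  choose s hs using hsign
  exact ⟨σ, s, fun z hz i => hs i z hz⟩

end IsOpenDiffeo

/-! ### Identifiability of the quantized coordinates -/

/-- Here `S = Function.support p` is the support of the density of `Z`, and `S ⊆ 𝒵` says that `Z`
takes its values in `𝒵`. A density of `Z' = g (f Z)` is only determined up to null sets; it is
taken, as in the change of variables formula, to be nonzero exactly on the image of `S`. -/
theorem theorem3 {Ω : Type*} [MeasurableSpace Ω] (P : Measure Ω) [IsProbabilityMeasure P]
    (d D : ℕ) (Z : Ω → Euc d) (hZ : Measurable Z)
    (p : Euc d → ℝ) (hp : IsPDFOf p Z P)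
    (𝒵 : Set (Euc d)) (h𝒵 : Function.support p ⊆ 𝒵)
    (𝒳 : Set (Euc D)) (f : Euc d → Euc D) (hf : IsDiffeoOn f 𝒵 𝒳)
    (hopen : IsOpen (Function.support p)) (hconn : IsConnected (Function.support p))
    (A : DiscreteCoordination d)
    (hgrid : IsAxisAlignedGrid (Function.support p) (nonRemovableDiscontinuities p) A)
    (hbackbone : HasBackbone (Function.support p) A) :
    (∃ (𝒵' : Set (Euc d)) (g : Euc D → Euc d) (p' : Euc d → ℝ) (B : DiscreteCoordination d),
      IsDiffeoOn g 𝒳 𝒵' ∧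
      IsPDFOf p' (fun ω => g (f (Z ω))) P ∧
      Function.support p' = (fun z => g (f z)) '' Function.support p ∧
      IsAxisAlignedGrid (Function.support p') (nonRemovableDiscontinuities p') B ∧
      ∀ i, 0 < B.size i) ∧
    (∀ (𝒵' : Set (Euc d)) (g : Euc D → Euc d) (p' : Euc d → ℝ) (B : DiscreteCoordination d),
      IsDiffeoOn g 𝒳 𝒵' →
      IsPDFOf p' (fun ω => g (f (Z ω))) P →
      Function.support p' = (fun z => g (f z)) '' Function.support p →
      IsAxisAlignedGrid (Function.support p') (nonRemovableDiscontinuities p') B →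
      ∃ (σ : Equiv.Perm (Fin d)) (s : Fin d → ℤˣ),
        (∀ᵐ ω ∂P, ∀ i,
          quantizeSign (s i) (g (f (Z ω)) (σ i)) (B.thr (σ i)) = quantize (Z ω i) (A.thr i)) ∧
        ∀ z ∈ Function.support p, ∀ i,
          quantizeSign (s i) (g (f z) (σ i)) (B.thr (σ i)) = quantize (z i) (A.thr i)) := by
  have haeS := hp.ae_mem_support hZ
  obtain ⟨f', hf'inv, hf'⟩ := hf.exists_inv
  -- Existence: the inverse of `f` recovers `Z` almost surely, with the same density and grid.
  refine ⟨⟨𝒵, f', p, A, ⟨?_, hf', f, hf'inv.symm, hf.contDiffOn⟩, ⟨hp.measurable, hp.nonneg, ?_⟩,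
    ?_, hgrid, fun i => ?_⟩, ?_⟩
  · exact hf.bijOn.symm hf'inv.symm
  · rw [← hp.map_eq]
    refine Measure.map_congr ?_
    filter_upwards [haeS] with ω hω using hf'inv.1 (h𝒵 hω)
  · have : EqOn (fun z => f' (f z)) id (Function.support p) := fun z hz => hf'inv.1 (h𝒵 hz)
    rw [this.image_eq, image_id]
  · obtain ⟨c, -⟩ := hbackbone
    exact (c i).pos
  · intro 𝒵' g p' B hg hp' hsupp hgrid'
    obtain ⟨g', hg'inv, hg'⟩ := hg.exists_inv
    have hfS : MapsTo f (Function.support p) 𝒳 := hf.bijOn.mapsTo.mono_left h𝒵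
    have hsub : (fun z => g (f z)) '' Function.support p ⊆ 𝒵' := by
      rintro _ ⟨z, hz, rfl⟩
      exact hg.bijOn.mapsTo (hfS hz)
    have H : IsOpenDiffeo (fun z => g (f z)) (fun y => f' (g' y)) (Function.support p)
        (Function.support p') := by
      rw [hsupp]
      refine IsOpenDiffeo.of_image hopen (fun z hz => ?_) ?_ ?_
      · rw [hg'inv.1 (hfS hz), hf'inv.1 (h𝒵 hz)]
      · exact hg.contDiffOn.comp (hf.contDiffOn.mono h𝒵) hfS
      · refine hf'.comp (hg'.mono hsub) fun y hy => ?_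
        obtain ⟨x, hx, rfl⟩ := hg.bijOn.surjOn (hsub hy)
        rwa [hg'inv.1 hx]
    obtain ⟨hAB, hBA⟩ := H.mapsTo_nonRemovableDiscontinuities hZ hp hp' rfl rfl
    rw [hgrid.2, hgrid'.2] at hAB hBA
    obtain ⟨σ, s, hσ⟩ := H.exists_quantizeSign_eq hgrid.1 hgrid'.1 hAB hBA hbackbone
    exact ⟨σ, s, haeS.mono fun ω hω => hσ (Z ω) hω, hσ⟩
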